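/- For $n\ge 1$ let $\mathcal P_n=\{(\vartheta_1,\dots,\vartheta_n)\in\mathbb R^n : \vartheta_k>0 \text{ for all } k,\ \sum_{k=1}^n\vartheta_k=1\}$. For $a,b\in\mathcal P_n$ write $a\prec b$ ($a$ is majorized by $b$) if $\sum_{l=1}^k a_l^{\downarrow}\le\sum_{l=1}^k b_l^{\downarrow}$ for all $1\le k<n$, where $a^{\downarrow},b^{\downarrow}$ are the decreasing rearrangements of $a,b$. For $\alpha\ne 1$ let $g_\alpha$ be the Riemannian metric on $\mathcal P_n$ obtained by pulling back the Euclidean metric of $\mathbb R^n$ along the map $\vartheta\mapsto\frac{2}{1-\alpha}\bigl(\vartheta_1^{(1-\alpha)/2},\dots,\vartheta_n^{(1-\alpha)/2}\bigr)$, and let $\mathrm{Scal}$ denote the scalar curvature of $(\mathcal P_n,g_\alpha)$. The Gibilisco--Isola conjecture for $(\mathcal P_n,g_\alpha)$ says that, for all $a,b\in\mathcal P_n$ with $a\prec b$, one has $\mathrm{Scal}(a)\le\mathrm{Scal}(b)$ if $\alpha\in\left]-1,0\right[$, and $\mathrm{Scal}(a)\ge\mathrm{Scal}(b)$ if $\alpha\in\left]0,1\right[$.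 **Corollary (simplification of the Gibilisco--Isola conjecture for $\mathcal P_3$).** Let $\alpha\in\left]-1,0\right[\,\cup\,\left]0,1\right[$. Suppose that for every $(a_1,a_2,a_3)\in\mathcal P_3$ with $a_1>a_2$ the function $$\left[0,\tfrac{a_1-a_2}{2}\right]\to\mathbb R,\qquad x\mapsto\frac{(a_1-x)^{\alpha}(a_2+x)^{\alpha}}{\bigl((a_1-x)^{\alpha+1}+(a_2+x)^{\alpha+1}+a_3^{\alpha+1}\bigr)^{2}}$$ is (weakly) decreasing if $\alpha\in\left]-1,0\right[$, respectively (weakly) increasing if $\alpha\in\left]0,1\right[$. Then the Gibilisco--Isola conjecture holds for $(\mathcal P_3,g_\alpha)$: for all $a,b\in\mathcal P_3$ with $a\prec b$, $\mathrm{Scal}(a)\le\mathrm{Scal}(b)$ if $\alpha\in\left]-1,0\right[$, respectively $\mathrm{Scal}(a)\ge\mathrm{Scal}(b)$ if $\alpha\in\left]0,1\right[$. -/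

import Mathlib

noncomputable section

namespace AlphaGeometry

/-! ### Riemannian geometry in a coordinate chart -/

/-- The `i`-th partial derivative of a real function of `d` real coordinates. -/
def pd {d : ℕ} (i : Fin d) (f : (Fin d → ℝ) → ℝ) (x : Fin d → ℝ) : ℝ :=
  lineDeriv ℝ f x (Pi.single i 1)

/-- The Gram matrix `(g_{ij})` of the pull-back, by a map `Φ` from coordinate space to `ℝ^N`, of the
canonical metric `g_c(u, v) = ∑ k, u k * v k` of `ℝ^N`. -/
def pullbackMetric {d N : ℕ} (Φ : (Fin d → ℝ) → (Fin N → ℝ)) (x : Fin d → ℝ) :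
    Matrix (Fin d) (Fin d) ℝ :=
  Matrix.of fun i j => ∑ k, pd i (fun y => Φ y k) x * pd j (fun y => Φ y k) x

/-- The Christoffel symbol `Γ_{ij}^k` of the Levi-Civita connection of the metric `g`. -/
def christoffel {d : ℕ} (g : (Fin d → ℝ) → Matrix (Fin d) (Fin d) ℝ) (i j k : Fin d)
    (x : Fin d → ℝ) : ℝ :=
  (1 / 2) * ∑ m, (g x)⁻¹ k m *
    (pd i (fun y => g y j m) x + pd j (fun y => g y i m) x - pd m (fun y => g y i j) x)

/-- The component along `∂_l` of `R(∂_i, ∂_j) ∂_k`, where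
`R(X, Y) Z = ∇_X ∇_Y Z - ∇_Y ∇_X Z - ∇_[X,Y] Z`. -/
def riemann {d : ℕ} (g : (Fin d → ℝ) → Matrix (Fin d) (Fin d) ℝ) (i j k l : Fin d)
    (x : Fin d → ℝ) : ℝ :=
  pd i (christoffel g j k l) x - pd j (christoffel g i k l) x
    + ∑ m, (christoffel g j k m x * christoffel g i m l x
      - christoffel g i k m x * christoffel g j m l x)

/-- The Ricci tensor `Ric(∂_j, ∂_k)`, the trace of `X ↦ R(X, ∂_j) ∂_k`. -/
def ricci {d : ℕ} (g : (Fin d → ℝ) → Matrix (Fin d) (Fin d) ℝ) (j k : Fin d)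
    (x : Fin d → ℝ) : ℝ :=
  ∑ i, riemann g i j k i x

/-- The scalar curvature of the metric `g` (positive on round spheres). -/
def scalarCurvature {d : ℕ} (g : (Fin d → ℝ) → Matrix (Fin d) (Fin d) ℝ) (x : Fin d → ℝ) : ℝ :=
  ∑ j, ∑ k, (g x)⁻¹ j k * ricci g j k x

/-! ### The space of probability distributions and its `α`-geometry -/

/-- The space `𝒫_n` of the strictly positive probability distributions on `n` points. -/
def P (n : ℕ) : Set (Fin n → ℝ) :=
  {ϑ | (∀ k, 0 < ϑ k) ∧ ∑ k, ϑ k = 1}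

/-- The map `φ_{α,n}` that induces the `α`-geometry. -/
def phi (α : ℝ) {n : ℕ} (ϑ : Fin n → ℝ) : Fin n → ℝ := fun k =>
  if α = 1 then Real.log (ϑ k) else 2 / (1 - α) * ϑ k ^ ((1 - α) / 2)

/-- The global chart of `𝒫_{n+1}`, which forgets the last coordinate. -/
def chart {n : ℕ} (ϑ : Fin (n + 1) → ℝ) : Fin n → ℝ := fun i => ϑ i.castSucc

/-- The inverse of the chart: the last coordinate is `1` minus the sum of the others. -/
def chartInv {n : ℕ} (x : Fin n → ℝ) : Fin (n + 1) → ℝ :=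
  Fin.snoc (α := fun _ => ℝ) x (1 - ∑ i, x i)

theorem chartInv_chart {n : ℕ} {ϑ : Fin (n + 1) → ℝ} (h : ϑ ∈ P (n + 1)) :
    chartInv (chart ϑ) = ϑ := by
  have hs := h.2
  rw [Fin.sum_univ_castSucc] at hs
  funext i
  refine Fin.lastCases ?_ (fun j => ?_) i
  · simp only [chartInv, chart, Fin.snoc_last]
    linarith
  · simp [chartInv, chart]

/-- The metric `g_α` of `𝒫_{n+1}` in the chart: the pull-back of `g_c` by `φ_{α,n+1}`. -/
def alphaMetric (α : ℝ) (n : ℕ) : (Fin n → ℝ) → Matrix (Fin n) (Fin n) ℝ :=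
  pullbackMetric fun x => phi α (chartInv x)

/-- The scalar curvature of the Riemannian manifold `(𝒫_{n+1}, g_α)` at the point `ϑ`. -/
def Scal (α : ℝ) {n : ℕ} (ϑ : Fin (n + 1) → ℝ) : ℝ :=
  scalarCurvature (alphaMetric α n) (chart ϑ)

/-! ### Majorization -/

/-- The decreasing rearrangement `a^↓` of `a`. -/
def decr {n : ℕ} (a : Fin n → ℝ) : Fin n → ℝ := fun i => a (Tuple.sort a i.rev)

theorem decr_antitone {n : ℕ} (a : Fin n → ℝ) : Antitone (decr a) := fun _ _ h =>
  Tuple.monotone_sort a (Fin.rev_le_rev.2 h)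

/-- The distribution `a` is majorized by the distribution `b`, that is `a ≺ b`: for `1 ≤ k < n`, the
sum of the `k` largest entries of `a` is at most that of `b`. -/
def Majorized {n : ℕ} (a b : Fin n → ℝ) : Prop :=
  ∀ k : ℕ, 1 ≤ k → k < n →
    ∑ l : Fin n with l.val < k, decr a l ≤ ∑ l : Fin n with l.val < k, decr b l

/-! ### Monotonicity of the scalar curvature -/

/-- The scalar curvature of `(𝒫_{n+1}, g_α)` is increasing with respect to majorization. -/
def ScalIncreasing (n : ℕ) (α : ℝ) : Prop :=
  ∀ a ∈ P (n + 1), ∀ b ∈ P (n + 1), Majorized a b → Scal α a ≤ Scal α b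

/-- The scalar curvature of `(𝒫_{n+1}, g_α)` is decreasing with respect to majorization. -/
def ScalDecreasing (n : ℕ) (α : ℝ) : Prop :=
  ∀ a ∈ P (n + 1), ∀ b ∈ P (n + 1), Majorized a b → Scal α b ≤ Scal α a

end AlphaGeometry

end

open AlphaGeometry

/-! The metric is a sum over the three probabilities of weights `ϑ_n ^ (-(α + 1))`, each depending
on one probability, against constant velocities. Hence the derivatives of the metric are totally
symmetric, and in the curvature the second derivatives of the weights cancel
(`weight_curvature_identity`). This yields the closed form `Scal_eq`: a nonnegative constant times a
symmetric function of the probabilities.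

For triples, majorization is a composition of two transfers from a larger entry to a smaller one
that do not reverse their order (`le_of_majorized_of_transfer`). A transfer fixes the third entry
`w`, so the profile changes only through the function in the hypothesis, multiplied by the constant
`w ^ α`. -/

/-! ### The metric in the chart -/

/-- The velocity of the three probabilities along the coordinate direction `i`. -/
def coordVelocity (i : Fin 2) : Fin 3 → ℝ := ![![1, 0, -1], ![0, 1, -1]] i

/-- The determinant of the metric with coordinate weights `p`. -/
def weightDet (p : Fin 3 → ℝ) : ℝ := p 0 * p 1 + p 0 * p 2 + p 1 * p 2

/-- The adjugate of the metric with coordinate weights `p`. -/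
def weightAdj (p : Fin 3 → ℝ) : Matrix (Fin 2) (Fin 2) ℝ :=
  !![p 1 + p 2, -p 2; -p 2, p 0 + p 2]

/-- Twice the Christoffel symbols of the first kind, for weights with derivatives `q`. -/
def weightChristoffel (q : Fin 3 → ℝ) (i j m : Fin 2) : ℝ :=
  ∑ n, q n * coordVelocity i n * coordVelocity j n * coordVelocity m n

theorem chartInv_line (x : Fin 2 → ℝ) (i : Fin 2) (n : Fin 3) (t : ℝ) :
    chartInv (x + t • Pi.single i (1 : ℝ)) n = chartInv x n + t * coordVelocity i n := by
  fin_cases n <;> fin_cases i <;>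
    simp [chartInv, coordVelocity, Fin.snoc, Fin.sum_univ_two] <;> ring

theorem HasDerivAt.hasLineDerivAt_chartInv {h : ℝ → ℝ} {h' : ℝ} {x : Fin 2 → ℝ} {n : Fin 3}
    (hh : HasDerivAt h h' (chartInv x n)) (i : Fin 2) :
    HasLineDerivAt ℝ (fun y => h (chartInv y n)) (h' * coordVelocity i n) x (Pi.single i 1) := by
  unfold HasLineDerivAt
  simp only [chartInv_line]
  have h1 : HasDerivAt (fun t : ℝ => chartInv x n + t * coordVelocity i n)
      (coordVelocity i n) 0 := by
    simpa using ((hasDerivAt_id (0 : ℝ)).mul_const (coordVelocity i n)).const_add (chartInv x n)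
  have h2 : HasDerivAt h h' (chartInv x n + 0 * coordVelocity i n) := by simpa using hh
  exact h2.comp (0 : ℝ) h1

theorem eventually_chartInv_pos {x : Fin 2 → ℝ} (hx : ∀ n, 0 < chartInv x n) :
    ∀ᶠ y in nhds x, ∀ n, 0 < chartInv y n := by
  have hc : ∀ n : Fin 3, Continuous fun y : Fin 2 → ℝ => chartInv y n := by
    intro n
    fin_cases n <;> simp [chartInv, Fin.snoc] <;> fun_prop
  exact Filter.eventually_all.2 fun n => (hc n).continuousAt.eventually (lt_mem_nhds (hx n))

/-- The closed formulas hold only where all probabilities are positive; that set is open, and a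
partial derivative depends only on the germ. -/
theorem pd_eq_of_forall_pos {f g : (Fin 2 → ℝ) → ℝ} {x : Fin 2 → ℝ}
    (hx : ∀ n, 0 < chartInv x n) (hfg : ∀ y, (∀ n, 0 < chartInv y n) → f y = g y)
    {i : Fin 2} {d : ℝ} (hg : HasLineDerivAt ℝ g d x (Pi.single i 1)) : pd i f x = d := by
  have h : f =ᶠ[nhds x] g := (eventually_chartInv_pos hx).mono hfg
  rw [pd, h.lineDeriv_eq, hg.lineDeriv]

theorem hasDerivAt_const_mul_rpow (c s : ℝ) {θ : ℝ} (hθ : 0 < θ) :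
    HasDerivAt (fun t : ℝ => c * t ^ s) (c * s * θ ^ (s - 1)) θ := by
  simpa [mul_assoc] using (Real.hasDerivAt_rpow_const (Or.inl hθ.ne')).const_mul c

theorem alphaMetric_apply {α : ℝ} (hα : α ≠ 1) {x : Fin 2 → ℝ} (hx : ∀ n, 0 < chartInv x n)
    (i j : Fin 2) :
    alphaMetric α 2 x i j =
      ∑ n, chartInv x n ^ (-(α + 1)) * coordVelocity i n * coordVelocity j n := by
  have hpd : ∀ (k : Fin 2) (n : Fin 3), pd k (fun y => phi α (chartInv y) n) x =
      chartInv x n ^ (-(α + 1) / 2) * coordVelocity k n := by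
    intro k n
    refine pd_eq_of_forall_pos hx (fun y _ => by rw [phi, if_neg hα]) ?_
    have h1 : 1 - α ≠ 0 := sub_ne_zero.2 hα.symm
    convert (hasDerivAt_const_mul_rpow (2 / (1 - α)) ((1 - α) / 2)
      (hx n)).hasLineDerivAt_chartInv k using 2
    rw [show (1 - α) / 2 - 1 = -(α + 1) / 2 by ring]
    field_simp
  simp only [alphaMetric, pullbackMetric, Matrix.of_apply, hpd]
  refine Finset.sum_congr rfl fun n _ => ?_
  rw [show -(α + 1) = -(α + 1) / 2 + -(α + 1) / 2 by ring, Real.rpow_add (hx n)]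
  ring_nf

theorem pd_alphaMetric {α : ℝ} (hα : α ≠ 1) {x : Fin 2 → ℝ} (hx : ∀ n, 0 < chartInv x n)
    (i j k : Fin 2) :
    pd i (fun y => alphaMetric α 2 y j k) x =
      weightChristoffel (fun n => -(α + 1) * chartInv x n ^ (-(α + 1) - 1)) i j k := by
  refine pd_eq_of_forall_pos hx (fun y hy => alphaMetric_apply hα hy j k) ?_
  have h : ∀ n : Fin 3, HasLineDerivAt ℝ (fun y : Fin 2 → ℝ =>
      chartInv y n ^ (-(α + 1)) * coordVelocity j n * coordVelocity k n)
      (-(α + 1) * chartInv x n ^ (-(α + 1) - 1) * coordVelocity i n * coordVelocity j n *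
        coordVelocity k n) x (Pi.single i 1) := by
    intro n
    have h1 := ((hasDerivAt_const_mul_rpow 1 (-(α + 1)) (hx n)).hasLineDerivAt_chartInv i)
    simp only [one_mul] at h1
    exact (HasDerivAt.mul_const (HasDerivAt.mul_const h1 _) _)
  exact HasDerivAt.fun_sum fun n _ => h n

theorem weightDet_pos {p : Fin 3 → ℝ} (hp : ∀ n, 0 < p n) : 0 < weightDet p := by
  have := hp 0; have := hp 1; have := hp 2
  unfold weightDet
  positivity

theorem inv_alphaMetric {α : ℝ} (hα : α ≠ 1) {x : Fin 2 → ℝ} (hx : ∀ n, 0 < chartInv x n) :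
    (alphaMetric α 2 x)⁻¹ = (weightDet fun n => chartInv x n ^ (-(α + 1)))⁻¹ •
      weightAdj fun n => chartInv x n ^ (-(α + 1)) := by
  have hm : alphaMetric α 2 x = !![chartInv x 0 ^ (-(α + 1)) + chartInv x 2 ^ (-(α + 1)),
      chartInv x 2 ^ (-(α + 1)); chartInv x 2 ^ (-(α + 1)),
      chartInv x 1 ^ (-(α + 1)) + chartInv x 2 ^ (-(α + 1))] := by
    ext i j
    rw [alphaMetric_apply hα hx]
    fin_cases i <;> fin_cases j <;> simp [coordVelocity, Fin.sum_univ_three]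
  rw [hm, Matrix.inv_def, Matrix.det_fin_two_of, Matrix.adjugate_fin_two_of,
    Ring.inverse_eq_inv']
  congr 2
  unfold weightDet
  ring

/-- Total symmetry makes the three metric derivatives in a Christoffel symbol equal, so their signed
sum is a single term. -/
theorem weightChristoffel_comm (q : Fin 3 → ℝ) (i j m : Fin 2) :
    weightChristoffel q j i m = weightChristoffel q i j m ∧
      weightChristoffel q m i j = weightChristoffel q i j m := by
  constructor <;> exact Finset.sum_congr rfl fun n _ => by ring

/-! ### Christoffel symbols and their derivatives -/

theorem christoffel_alphaMetric {α : ℝ} (hα : α ≠ 1) {x : Fin 2 → ℝ}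
    (hx : ∀ n, 0 < chartInv x n) (i j k : Fin 2) :
    christoffel (alphaMetric α 2) i j k x =
      (1 / 2) * (∑ m, weightAdj (fun n => chartInv x n ^ (-(α + 1))) k m * weightChristoffel
        (fun n => -(α + 1) * chartInv x n ^ (-(α + 1) - 1)) i j m) /
        weightDet (fun n => chartInv x n ^ (-(α + 1))) := by
  simp only [christoffel, pd_alphaMetric hα hx, inv_alphaMetric hα hx, Matrix.smul_apply,
    smul_eq_mul, Fin.sum_univ_two, (weightChristoffel_comm _ i j _).1,
    (weightChristoffel_comm _ i j _).2]
  ring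

theorem hasDerivAt_christoffel_quotient {P Q : ℝ → Fin 3 → ℝ} {p' q' : Fin 3 → ℝ} {t : ℝ}
    (hP : ∀ n, HasDerivAt (fun s => P s n) (p' n) t)
    (hQ : ∀ n, HasDerivAt (fun s => Q s n) (q' n) t) (hD : weightDet (P t) ≠ 0)
    (i j k : Fin 2) :
    HasDerivAt (fun s => (1 / 2) * (∑ m, weightAdj (P s) k m * weightChristoffel (Q s) i j m) /
        weightDet (P s))
      (((1 / 2) * (∑ m, (weightAdj p' k m * weightChristoffel (Q t) i j m +
          weightAdj (P t) k m * weightChristoffel q' i j m)) * weightDet (P t) -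
        (1 / 2) * (∑ m, weightAdj (P t) k m * weightChristoffel (Q t) i j m) *
          (p' 0 * P t 1 + P t 0 * p' 1 + (p' 0 * P t 2 + P t 0 * p' 2) +
            (p' 1 * P t 2 + P t 1 * p' 2))) / weightDet (P t) ^ 2) t := by
  have hA : ∀ m, HasDerivAt (fun s => weightAdj (P s) k m) (weightAdj p' k m) t := by
    intro m
    fin_cases k <;> fin_cases m <;> simp only [weightAdj] <;>
      [exact (hP 1).add (hP 2); exact (hP 2).neg; exact (hP 2).neg; exact (hP 0).add (hP 2)]
  have hE : ∀ m, HasDerivAt (fun s => weightChristoffel (Q s) i j m)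
      (weightChristoffel q' i j m) t := fun m =>
    HasDerivAt.fun_sum fun n _ => (((hQ n).mul_const _).mul_const _).mul_const _
  have hDet : HasDerivAt (fun s => weightDet (P s)) (p' 0 * P t 1 + P t 0 * p' 1 +
      (p' 0 * P t 2 + P t 0 * p' 2) + (p' 1 * P t 2 + P t 1 * p' 2)) t :=
    (((hP 0).mul (hP 1)).add ((hP 0).mul (hP 2))).add ((hP 1).mul (hP 2))
  exact ((HasDerivAt.fun_sum fun m _ => (hA m).mul (hE m)).const_mul _).div hDet hD

/-- The value of the derivative of a Christoffel symbol, for weights `p` with first and second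
derivatives `q` and `r`. -/
noncomputable def weightChristoffelDeriv (p q r : Fin 3 → ℝ) (l i j k : Fin 2) : ℝ :=
  let v := coordVelocity l
  ((1 / 2) * (∑ m, (weightAdj (q * v) k m * weightChristoffel q i j m +
      weightAdj p k m * weightChristoffel (r * v) i j m)) * weightDet p -
    (1 / 2) * (∑ m, weightAdj p k m * weightChristoffel q i j m) *
      (q 0 * v 0 * p 1 + p 0 * (q 1 * v 1) + (q 0 * v 0 * p 2 + p 0 * (q 2 * v 2)) +
        (q 1 * v 1 * p 2 + p 1 * (q 2 * v 2)))) / weightDet p ^ 2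

theorem pd_christoffel_alphaMetric {α : ℝ} (hα : α ≠ 1) {x : Fin 2 → ℝ}
    (hx : ∀ n, 0 < chartInv x n) (l i j k : Fin 2) :
    pd l (christoffel (alphaMetric α 2) i j k) x =
      weightChristoffelDeriv (fun n => chartInv x n ^ (-(α + 1)))
        (fun n => -(α + 1) * chartInv x n ^ (-(α + 1) - 1))
        (fun n => -(α + 1) * (-(α + 1) - 1) * chartInv x n ^ (-(α + 1) - 1 - 1)) l i j k := by
  refine pd_eq_of_forall_pos hx (fun y hy => christoffel_alphaMetric hα hy i j k) ?_
  have h1 : ∀ n, HasLineDerivAt ℝ (fun y : Fin 2 → ℝ => chartInv y n ^ (-(α + 1)))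
      (-(α + 1) * chartInv x n ^ (-(α + 1) - 1) * coordVelocity l n) x (Pi.single l 1) := by
    intro n
    simpa using (hasDerivAt_const_mul_rpow 1 (-(α + 1)) (hx n)).hasLineDerivAt_chartInv l
  have h2 := fun n => (hasDerivAt_const_mul_rpow (-(α + 1)) (-(α + 1) - 1)
    (hx n)).hasLineDerivAt_chartInv l
  -- A line derivative is by definition an ordinary derivative at `t = 0`, so the one-variable
  -- quotient rule applies along the coordinate line.
  have h3 := hasDerivAt_christoffel_quotient h1 h2
    (by simpa using (weightDet_pos fun n => Real.rpow_pos_of_pos (hx n) _).ne') i j k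
  simp only [zero_smul, add_zero] at h3
  exact h3

/-! ### The scalar curvature in closed form -/

/-- The curvature identity behind the computation of the scalar curvature: second derivatives of
the weights cancel. -/
theorem weight_curvature_identity (p q r : Fin 3 → ℝ) (hp : weightDet p ≠ 0)
    (Γ : Fin 2 → Fin 2 → Fin 2 → ℝ) (hΓ : ∀ i j k, Γ i j k =
      (1 / 2) * (∑ m, weightAdj p k m * weightChristoffel q i j m) / weightDet p) :
    ∑ j, ∑ k, ((weightDet p)⁻¹ • weightAdj p) j k * ∑ i,
      (weightChristoffelDeriv p q r i j k i - weightChristoffelDeriv p q r j i k i +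
        ∑ m, (Γ j k m * Γ i m i - Γ i k m * Γ j m i)) =
      (q 0 * q 1 * p 2 + q 0 * q 2 * p 1 + q 1 * q 2 * p 0) / (2 * weightDet p ^ 2) := by
  have hD : weightDet p = p 0 * p 1 + p 0 * p 2 + p 1 * p 2 := rfl
  simp only [hΓ, weightChristoffelDeriv, weightChristoffel, weightAdj, coordVelocity,
    Fin.sum_univ_two, Fin.sum_univ_three, Matrix.smul_apply, smul_eq_mul, Pi.mul_apply]
  simp
  -- The determinant stays an atom while denominators are cleared, and is expanded only afterwards.
  generalize weightDet p = D at *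
  field_simp
  rw [hD]
  ring

theorem Scal_eq {α : ℝ} (hα : α ≠ 1) {a : Fin 3 → ℝ} (ha : a ∈ P 3) :
    Scal α a = (α + 1) ^ 2 / 2 * ((a 0 ^ α * a 1 ^ α * a 2 ^ α) /
      (a 0 ^ (α + 1) + a 1 ^ (α + 1) + a 2 ^ (α + 1)) ^ 2) := by
  have hc : chartInv (chart a) = a := chartInv_chart ha
  have hx : ∀ n, 0 < chartInv (chart a) n := by rw [hc]; exact ha.1
  have hpos := weightDet_pos fun n => Real.rpow_pos_of_pos (hx n) (-(α + 1))
  simp only [Scal, scalarCurvature, ricci, riemann, pd_christoffel_alphaMetric hα hx,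
    inv_alphaMetric hα hx]
  rw [weight_curvature_identity _ _ _ hpos.ne' (fun i j k => christoffel _ i j k _)
    fun i j k => christoffel_alphaMetric hα hx i j k]
  rw [hc]
  have hs : a 2 = 1 - a 0 - a 1 := by
    have := ha.2
    rw [Fin.sum_univ_three] at this
    linarith
  have e1 : ∀ n, a n ^ (-(α + 1)) = (a n ^ α * a n)⁻¹ := fun n => by
    rw [Real.rpow_neg (ha.1 n).le, Real.rpow_add_one (ha.1 n).ne']
  have e2 : ∀ n, a n ^ (-(α + 1) - 1) = (a n ^ α * a n)⁻¹ / a n := fun n => by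
    rw [Real.rpow_sub_one (ha.1 n).ne', e1]
  have e3 : ∀ n, a n ^ (α + 1) = a n ^ α * a n := fun n => Real.rpow_add_one (ha.1 n).ne' _
  simp only [weightDet, e1, e2, e3]
  have u := fun n => Real.rpow_pos_of_pos (ha.1 n) α
  have v := ha.1
  have := u 0; have := u 1; have := u 2
  have := v 0; have := v 1; have := v 2
  have hsum : a 0 + a 1 + a 2 = 1 := by linarith
  clear hs
  generalize a 0 ^ α = u0 at *
  generalize a 1 ^ α = u1 at *
  generalize a 2 ^ α = u2 at *
  generalize a 0 = x at *
  generalize a 1 = y at *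
  generalize a 2 = z at *
  rw [show (u0 * x)⁻¹ * (u1 * y)⁻¹ + (u0 * x)⁻¹ * (u2 * z)⁻¹ + (u1 * y)⁻¹ * (u2 * z)⁻¹ =
    (u0 * x + u1 * y + u2 * z) / (u0 * x * (u1 * y) * (u2 * z)) by field_simp; ring]
  have hS : 0 < u0 * x + u1 * y + u2 * z := by positivity
  generalize u0 * x + u1 * y + u2 * z = S at *
  -- The curvature numerator produces the factor `x + y + z`, which is the total probability 1.
  trans (α + 1) ^ 2 / 2 * ((u0 * u1 * u2) / S ^ 2) * (x + y + z)
  · field_simp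
    ring
  · rw [hsum, mul_one]

/-- The nonconstant factor of the scalar curvature of `𝒫_3`. -/
noncomputable def scalProfile (α u v w : ℝ) : ℝ :=
  (u ^ α * v ^ α * w ^ α) / (u ^ (α + 1) + v ^ (α + 1) + w ^ (α + 1)) ^ 2

theorem scalProfile_swap_left (α u v w : ℝ) : scalProfile α u v w = scalProfile α v u w := by
  unfold scalProfile
  ring_nf

theorem scalProfile_swap_right (α u v w : ℝ) : scalProfile α u v w = scalProfile α u w v := by
  unfold scalProfile
  ring_nf

theorem scalProfile_perm (α : ℝ) (a : Fin 3 → ℝ) (σ : Equiv.Perm (Fin 3)) :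
    scalProfile α (a (σ 0)) (a (σ 1)) (a (σ 2)) = scalProfile α (a 0) (a 1) (a 2) := by
  have h : ∀ f : Fin 3 → ℝ, scalProfile α (f 0) (f 1) (f 2) =
      (∏ n, f n ^ α) / (∑ n, f n ^ (α + 1)) ^ 2 := fun f => by
    rw [Fin.prod_univ_three, Fin.sum_univ_three, scalProfile]
  rw [h fun n => a (σ n), h a, Equiv.prod_comp σ fun n => a n ^ α,
    Equiv.sum_comp σ fun n => a n ^ (α + 1)]

theorem scalProfile_decr (α : ℝ) (a : Fin 3 → ℝ) :
    scalProfile α (decr a 0) (decr a 1) (decr a 2) = scalProfile α (a 0) (a 1) (a 2) :=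
  scalProfile_perm α a (Fin.revPerm.trans (Tuple.sort a))

theorem decr_mem_P {a : Fin 3 → ℝ} (ha : a ∈ P 3) : decr a ∈ P 3 :=
  ⟨fun _ => ha.1 _, (Equiv.sum_comp (Fin.revPerm.trans (Tuple.sort a)) a).trans ha.2⟩

/-! ### Majorization through transfers -/

/-- A relation between triples that contains all transfers between two entries, and is invariant
under exchanges of entries, contains majorization. -/
theorem le_of_majorized_of_transfer {F : ℝ → ℝ → ℝ → ℝ}
    (hl : ∀ u v w, F u v w = F v u w) (hr : ∀ u v w, F u v w = F u w v)
    (hF : ∀ u v w x, 0 < u → 0 < v → 0 < w → u + v + w = 1 → 0 ≤ x → v + x ≤ u - x →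
      F (u - x) (v + x) w ≤ F u v w)
    {a b : Fin 3 → ℝ} (ha : a ∈ P 3) (hb : b ∈ P 3) (hab : Majorized a b) :
    F (decr a 0) (decr a 1) (decr a 2) ≤ F (decr b 0) (decr b 1) (decr b 2) := by
  have h1 := hab 1 le_rfl (by norm_num)
  have h2 := hab 2 (by norm_num) (by norm_num)
  have ma := decr_mem_P ha
  have mb := decr_mem_P hb
  have sa := ma.2
  have sb := mb.2
  have a01 := decr_antitone a (show (0 : Fin 3) ≤ 1 by decide)
  have a12 := decr_antitone a (show (1 : Fin 3) ≤ 2 by decide)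
  have pa := ma.1
  have pb := mb.1
  simp only [Finset.sum_filter, Fin.sum_univ_three] at h1 h2 sa sb
  norm_num at h1 h2
  have := pa 0; have := pa 1; have := pa 2
  have := pb 0; have := pb 1; have := pb 2
  generalize decr a 0 = a0 at *
  generalize decr a 1 = a1 at *
  generalize decr a 2 = a2 at *
  generalize decr b 0 = b0 at *
  generalize decr b 1 = b1 at *
  generalize decr b 2 = b2 at *
  -- If `b1 ≤ a1`, the largest entry of `b` gives to both others. Otherwise the smallest receives
  -- from both others. Either way each transfer brings one entry to its value in `a`.
  rcases le_total b1 a1 with h | h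
  · calc F a0 a1 a2 = F (b0 - (a1 - b1) - (a2 - b2)) (b2 + (a2 - b2)) a1 := by
          rw [hr]; congr 1 <;> linarith
      _ ≤ F (b0 - (a1 - b1)) b2 a1 := by apply hF <;> linarith
      _ = F (b0 - (a1 - b1)) (b1 + (a1 - b1)) b2 := by rw [hr]; congr 1; ring
      _ ≤ F b0 b1 b2 := by apply hF <;> linarith
  · calc F a0 a1 a2 = F (b1 - (b1 - a1)) (b2 + (b0 - a0) + (b1 - a1)) a0 := by
          rw [hl, hr]; congr 1 <;> linarith
      _ ≤ F b1 (b2 + (b0 - a0)) a0 := by apply hF <;> linarith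
      _ = F (b0 - (b0 - a0)) (b2 + (b0 - a0)) b1 := by
          rw [hr, hl, hr]; congr 1; ring
      _ ≤ F b0 b2 b1 := by apply hF <;> linarith
      _ = F b0 b1 b2 := hr _ _ _

/-! ### Reduction to the hypothesis on transfers -/

theorem scalProfile_eq_mul (α u v w : ℝ) : scalProfile α u v w =
    u ^ α * v ^ α / (u ^ (α + 1) + v ^ (α + 1) + w ^ (α + 1)) ^ 2 * w ^ α := by
  unfold scalProfile
  ring

theorem vec_mem_P {u v w : ℝ} (hu : 0 < u) (hv : 0 < v) (hw : 0 < w) (h : u + v + w = 1) :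
    ![u, v, w] ∈ P 3 := by
  refine ⟨fun k => ?_, by simpa [Fin.sum_univ_three] using h⟩
  fin_cases k <;> assumption

theorem Scal_eq_scalProfile {α : ℝ} (hα : α ≠ 1) {a : Fin 3 → ℝ} (ha : a ∈ P 3) :
    Scal α a = (α + 1) ^ 2 / 2 * scalProfile α (decr a 0) (decr a 1) (decr a 2) := by
  rw [scalProfile_decr, Scal_eq hα ha, scalProfile]

theorem mainTheorem6 :
    (∀ α : ℝ, -1 < α → α < 0 →
      (∀ a : Fin 3 → ℝ, a ∈ AlphaGeometry.P 3 → a 0 > a 1 →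
        AntitoneOn
          (fun x : ℝ => (a 0 - x) ^ α * (a 1 + x) ^ α /
            ((a 0 - x) ^ (α + 1) + (a 1 + x) ^ (α + 1) + a 2 ^ (α + 1)) ^ 2)
          (Set.Icc 0 ((a 0 - a 1) / 2))) →
      AlphaGeometry.ScalIncreasing 2 α) ∧
    (∀ α : ℝ, 0 < α → α < 1 →
      (∀ a : Fin 3 → ℝ, a ∈ AlphaGeometry.P 3 → a 0 > a 1 →
        MonotoneOn
          (fun x : ℝ => (a 0 - x) ^ α * (a 1 + x) ^ α /
            ((a 0 - x) ^ (α + 1) + (a 1 + x) ^ (α + 1) + a 2 ^ (α + 1)) ^ 2)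
          (Set.Icc 0 ((a 0 - a 1) / 2))) →
      AlphaGeometry.ScalDecreasing 2 α) := by
  refine ⟨fun α _ h0 H a ha b hb hab => ?_, fun α _ h1 H a ha b hb hab => ?_⟩
  · rw [Scal_eq_scalProfile (by linarith) ha, Scal_eq_scalProfile (by linarith) hb]
    refine mul_le_mul_of_nonneg_left ?_ (by positivity)
    refine le_of_majorized_of_transfer (scalProfile_swap_left α) (scalProfile_swap_right α)
      (fun u v w x hu hv hw hs hx hxu => ?_) ha hb hab
    -- The hypothesis needs `u > v` strictly, which `v + x ≤ u - x` gives only for `x > 0`.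
    rcases hx.eq_or_lt with rfl | hx'
    · simp
    have h := H ![u, v, w] (vec_mem_P hu hv hw hs) (by simp; linarith)
      (show (0 : ℝ) ∈ _ by simp; linarith) (show x ∈ _ by simp [hx]; linarith) hx
    rw [scalProfile_eq_mul, scalProfile_eq_mul]
    refine mul_le_mul_of_nonneg_right ?_ (Real.rpow_nonneg hw.le _)
    simpa using h
  · rw [Scal_eq_scalProfile (by linarith) ha, Scal_eq_scalProfile (by linarith) hb]
    refine mul_le_mul_of_nonneg_left ?_ (by positivity)
    -- The decreasing case is the transfer principle for the negated profile.
    refine neg_le_neg_iff.1 (le_of_majorized_of_transfer (F := fun u v w => -scalProfile α u v w)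
      (fun u v w => congrArg Neg.neg (scalProfile_swap_left α u v w))
      (fun u v w => congrArg Neg.neg (scalProfile_swap_right α u v w))
      (fun u v w x hu hv hw hs hx hxu => ?_) ha hb hab)
    rcases hx.eq_or_lt with rfl | hx'
    · simp
    have h := H ![u, v, w] (vec_mem_P hu hv hw hs) (by simp; linarith)
      (show (0 : ℝ) ∈ _ by simp; linarith) (show x ∈ _ by simp [hx]; linarith) hx
    rw [neg_le_neg_iff, scalProfile_eq_mul, scalProfile_eq_mul]
    refine mul_le_mul_of_nonneg_right ?_ (Real.rpow_nonneg hw.le _)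
    simpa using h
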